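/- Let $\Omega \subset \mathbb{R}^n$ be a Borel set and let $F \subset \overline{\Omega}$ be closed and non-empty with $\lambda(F \cap \Omega) = 0$, where $\lambda$ is the Lebesgue measure. Let $\mathrm{ba}_w(\lambda)$ be the real vector space of all bounded, finitely additive set functions $\mu : \mathcal{B}(\Omega) \to \mathbb{R}$ on the Borel subsets of $\Omega$ such that $\mu(A) = 0$ whenever $\lambda(A) = 0$. It is identified with the dual of $L^\infty(\Omega, \lambda)$ through $\mu \mapsto \left(f \mapsto \int_\Omega f \, d\mu\right)$, where the integral of $f$ is the limit of the integrals of simple functions that converge to $f$ in measure with respect to $|\mu|$ and are Cauchy in $L^1(|\mu|)$. A density measure for $F$ is a $\mu \in \mathrm{ba}_w(\lambda)$ with $\mu \ge 0$ and $$\mu(F_\delta \cap \Omega) = \mu(\Omega) = 1 \quad \text{for all } \delta > 0,$$ where $F_\delta$ is the open $\delta$-neighbourhood of $F$. Then the set of all density measures for $F$ is a convex subset of $\mathrm{ba}_w(\lambda)$, and it is weak* compact as a subset of $\mathrm{ba}_w(\lambda) = (L^\infty(\Omega,\lambda))^*$. -/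

import Mathlib

open MeasureTheory Filter Topology
open scoped ENNReal

noncomputable section

namespace FinAdd

/-- Real-valued set functions on the measurable sets of `X`. -/
abbrev SetFun (X : Type*) [MeasurableSpace X] : Type _ := {A : Set X // MeasurableSet A} → ℝ

/-- `ba(X)`: bounded, finitely additive, real-valued set functions on the measurable sets. -/
def ba (X : Type*) [MeasurableSpace X] : Submodule ℝ (SetFun X) where
  carrier := {μ | (∀ A B : {A : Set X // MeasurableSet A}, Disjoint A.1 B.1 →
      μ ⟨A.1 ∪ B.1, A.2.union B.2⟩ = μ A + μ B) ∧ ∃ C : ℝ, ∀ A, |μ A| ≤ C}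
  add_mem' := by
    rintro μ η ⟨h1, C, hC⟩ ⟨h2, D, hD⟩
    refine ⟨fun A B h => ?_, C + D, fun A => (abs_add_le _ _).trans (add_le_add (hC A) (hD A))⟩
    simp only [Pi.add_apply, h1 A B h, h2 A B h]; ring
  zero_mem' := ⟨fun _ _ _ => by simp, 0, fun _ => by simp⟩
  smul_mem' := by
    rintro c μ ⟨h1, C, hC⟩
    refine ⟨fun A B h => ?_, |c| * C, fun A => ?_⟩
    · simp only [Pi.smul_apply, smul_eq_mul, h1 A B h]; ring
    · simp only [Pi.smul_apply, smul_eq_mul, abs_mul]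
      exact mul_le_mul_of_nonneg_left (hC A) (abs_nonneg c)

/-- `ba_w(X, ν)`: those members of `ba(X)` that are weakly absolutely continuous with respect
to `ν`, that is, vanish on every `ν`-null measurable set. -/
def baW {X : Type*} [MeasurableSpace X] (ν : Measure X) : Submodule ℝ (SetFun X) where
  carrier := {μ | μ ∈ ba X ∧ ∀ A, ν A.1 = 0 → μ A = 0}
  add_mem' := by
    rintro μ η ⟨h1, h2⟩ ⟨h3, h4⟩
    exact ⟨(ba X).add_mem h1 h3, fun A hA => by simp [h2 A hA, h4 A hA]⟩
  zero_mem' := ⟨(ba X).zero_mem, fun _ _ => rfl⟩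
  smul_mem' := by
    rintro c μ ⟨h1, h2⟩
    exact ⟨(ba X).smul_mem c h1, fun A hA => by simp [h2 A hA]⟩

variable {X : Type*} [MeasurableSpace X]

/-- The positive part `μ⁺(A) = sup {μ(B) : B ⊆ A measurable}`. -/
def posVar (μ : SetFun X) : SetFun X :=
  fun A => ⨆ B : {B : {B : Set X // MeasurableSet B} // B.1 ⊆ A.1}, μ B.1

/-- The total variation `|μ| = μ⁺ + μ⁻`, where `μ⁻ = (-μ)⁺`. -/
def totalVar (μ : SetFun X) : SetFun X := posVar μ + posVar (-μ)

/-- The outer measure `μ*(B) = inf {μ(A) : A ⊇ B measurable}` of a nonnegative `μ`,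
for an arbitrary set `B`. -/
def outer (μ : SetFun X) (B : Set X) : ℝ :=
  ⨅ A : {A : {A : Set X // MeasurableSet A} // B ⊆ A.1}, μ A.1

/-- The integral of a simple function: `∑ x, x * μ {s = x}`. -/
def simpleIntegral (μ : SetFun X) (s : SimpleFunc X ℝ) : ℝ :=
  ∑ x ∈ s.range, x * μ ⟨s ⁻¹' {x}, s.measurableSet_fiber x⟩

/-- Convergence in measure of `s k` to `f`: the outer measure `|μ|*` of the set
`{x : |s k x - f x| > ε}` tends to `0` for every `ε > 0`. -/
def ConvInMeasure (μ : SetFun X) (s : ℕ → X → ℝ) (f : X → ℝ) : Prop :=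
  ∀ ε : ℝ, 0 < ε → Tendsto (fun k => outer (totalVar μ) {x | ε < |s k x - f x|}) atTop (𝓝 0)

/-- `f` is integrable with respect to `μ` with integral `c`: there is a sequence of simple
functions that converges to `f` in measure, is Cauchy in `L¹(|μ|)`, and whose integrals with
respect to `μ` converge to `c`. -/
def HasIntegral (μ : SetFun X) (f : X → ℝ) (c : ℝ) : Prop :=
  ∃ s : ℕ → SimpleFunc X ℝ,
    ConvInMeasure μ (fun k => s k) f ∧
    Tendsto (fun p : ℕ × ℕ => simpleIntegral (totalVar μ) ((s p.1 - s p.2).map fun y => |y|))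
      atTop (𝓝 0) ∧
    Tendsto (fun k => simpleIntegral μ (s k)) atTop (𝓝 c)

open Classical in
/-- The integral of `f` with respect to `μ` (and `0` if `f` is not integrable). -/
def integral (μ : SetFun X) (f : X → ℝ) : ℝ :=
  if h : ∃ c, HasIntegral μ f c then h.choose else 0

section Facts

variable {ν : Measure X} {μ : SetFun X}

theorem ba_empty (hμ : μ ∈ ba X) : μ ⟨∅, .empty⟩ = 0 := by
  have := hμ.1 ⟨∅, .empty⟩ ⟨∅, .empty⟩ (by simp)
  simp only [Set.union_self] at this
  linarith

theorem posVar_bdd (hμ : μ ∈ ba X) (A : {A : Set X // MeasurableSet A}) :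
    BddAbove (Set.range fun B : {B : {B : Set X // MeasurableSet B} // B.1 ⊆ A.1} => μ B.1) := by
  obtain ⟨C, hC⟩ := hμ.2
  exact ⟨C, by rintro _ ⟨B, rfl⟩; exact (le_abs_self _).trans (hC _)⟩

theorem le_posVar (hμ : μ ∈ ba X) {A B : {A : Set X // MeasurableSet A}} (h : B.1 ⊆ A.1) :
    μ B ≤ posVar μ A :=
  le_ciSup (posVar_bdd hμ A) (⟨B, h⟩ : {B : {B : Set X // MeasurableSet B} // B.1 ⊆ A.1})

theorem posVar_le {A : {A : Set X // MeasurableSet A}} {c : ℝ}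
    (h : ∀ B : {B : Set X // MeasurableSet B}, B.1 ⊆ A.1 → μ B ≤ c) : posVar μ A ≤ c := by
  have : Nonempty {B : {B : Set X // MeasurableSet B} // B.1 ⊆ A.1} := ⟨⟨A, subset_rfl⟩⟩
  exact ciSup_le fun B => h B.1 B.2

theorem posVar_nonneg (hμ : μ ∈ ba X) (A : {A : Set X // MeasurableSet A}) :
    0 ≤ posVar μ A := by
  rw [← ba_empty hμ]
  exact le_posVar hμ (by simp)

theorem posVar_mem (hμ : μ ∈ ba X) : posVar μ ∈ ba X := by
  refine ⟨fun A B hAB => le_antisymm (posVar_le fun C hC => ?_) ?_, ?_⟩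
  · have h1 := hμ.1 ⟨C.1 ∩ A.1, C.2.inter A.2⟩ ⟨C.1 ∩ B.1, C.2.inter B.2⟩
      (hAB.mono Set.inter_subset_right Set.inter_subset_right)
    have h2 : (C.1 ∩ A.1) ∪ (C.1 ∩ B.1) = C.1 := by
      rw [← Set.inter_union_distrib_left]; exact Set.inter_eq_left.2 hC
    simp only [h2] at h1
    rw [show μ C = _ from h1]
    exact add_le_add (le_posVar hμ Set.inter_subset_right) (le_posVar hμ Set.inter_subset_right)
  · have key : ∀ C : {C : Set X // MeasurableSet C}, C.1 ⊆ A.1 → ∀ D : {C : Set X // MeasurableSet C},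
        D.1 ⊆ B.1 → μ C + μ D ≤ posVar μ ⟨A.1 ∪ B.1, A.2.union B.2⟩ := by
      intro C hC D hD
      rw [← hμ.1 C D (hAB.mono hC hD)]
      exact le_posVar hμ (Set.union_subset_union hC hD)
    have h1 : ∀ C : {C : Set X // MeasurableSet C}, C.1 ⊆ A.1 →
        posVar μ B ≤ posVar μ ⟨A.1 ∪ B.1, A.2.union B.2⟩ - μ C := fun C hC =>
      posVar_le fun D hD => by linarith [key C hC D hD]
    have h2 : posVar μ A ≤ posVar μ ⟨A.1 ∪ B.1, A.2.union B.2⟩ - posVar μ B :=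
      posVar_le fun C hC => by linarith [h1 C hC]
    linarith
  · obtain ⟨C, hC⟩ := hμ.2
    refine ⟨C, fun A => ?_⟩
    rw [abs_of_nonneg (posVar_nonneg hμ A)]
    exact posVar_le fun B _ => (le_abs_self _).trans (hC B)

theorem totalVar_mem (hμ : μ ∈ ba X) : totalVar μ ∈ ba X :=
  (ba X).add_mem (posVar_mem hμ) (posVar_mem ((ba X).neg_mem hμ))

theorem totalVar_nonneg (hμ : μ ∈ ba X) (A : {A : Set X // MeasurableSet A}) :
    0 ≤ totalVar μ A :=
  add_nonneg (posVar_nonneg hμ A) (posVar_nonneg ((ba X).neg_mem hμ) A)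

theorem abs_le_totalVar (hμ : μ ∈ ba X) (A : {A : Set X // MeasurableSet A}) :
    |μ A| ≤ totalVar μ A := by
  have h1 := le_posVar hμ (subset_refl A.1)
  have h2 := le_posVar ((ba X).neg_mem hμ) (subset_refl A.1)
  have h3 := posVar_nonneg hμ A
  have h4 := posVar_nonneg ((ba X).neg_mem hμ) A
  simp only [Pi.neg_apply] at h2
  simp only [totalVar, Pi.add_apply]
  exact abs_le.2 ⟨by linarith, by linarith⟩

theorem totalVar_null (hμ : μ ∈ baW ν) {A : {A : Set X // MeasurableSet A}} (hA : ν A.1 = 0) :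
    totalVar μ A = 0 := by
  have h : ∀ B : {A : Set X // MeasurableSet A}, B.1 ⊆ A.1 → μ B = 0 := fun B hB =>
    hμ.2 B (measure_mono_null hB hA)
  refine le_antisymm (add_nonpos ?_ ?_) (totalVar_nonneg hμ.1 A)
  · exact posVar_le fun B hB => (h B hB).le
  · exact posVar_le fun B hB => by simp [h B hB]

theorem ba_mono (hμ : μ ∈ ba X) (h0 : ∀ A, 0 ≤ μ A) {A B : {A : Set X // MeasurableSet A}}
    (h : A.1 ⊆ B.1) : μ A ≤ μ B := by
  have h1 := hμ.1 A ⟨B.1 \ A.1, B.2.diff A.2⟩ Set.disjoint_sdiff_right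
  simp only [Set.union_sdiff_cancel h] at h1
  rw [show μ B = _ from h1]
  linarith [h0 ⟨B.1 \ A.1, B.2.diff A.2⟩]

theorem ba_union_le (hμ : μ ∈ ba X) (h0 : ∀ A, 0 ≤ μ A) (A B : {A : Set X // MeasurableSet A}) :
    μ ⟨A.1 ∪ B.1, A.2.union B.2⟩ ≤ μ A + μ B := by
  have h1 := hμ.1 A ⟨B.1 \ A.1, B.2.diff A.2⟩ Set.disjoint_sdiff_right
  simp only [Set.union_sdiff_self] at h1
  rw [h1]
  linarith [ba_mono hμ h0 (A := ⟨B.1 \ A.1, B.2.diff A.2⟩) (B := B) Set.sdiff_subset]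

theorem outer_le (h0 : ∀ A, 0 ≤ μ A) {B : Set X} {A : {A : Set X // MeasurableSet A}}
    (h : B ⊆ A.1) : outer μ B ≤ μ A :=
  ciInf_le (⟨0, by rintro _ ⟨A, rfl⟩; exact h0 _⟩ : BddBelow (Set.range
    fun A : {A : {A : Set X // MeasurableSet A} // B ⊆ A.1} => μ A.1))
    (⟨A, h⟩ : {A : {A : Set X // MeasurableSet A} // B ⊆ A.1})

theorem exists_of_outer_lt {B : Set X} {c : ℝ} (h : outer μ B < c) :
    ∃ A : {A : Set X // MeasurableSet A}, B ⊆ A.1 ∧ μ A < c := by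
  have : Nonempty {A : {A : Set X // MeasurableSet A} // B ⊆ A.1} :=
    ⟨⟨⟨Set.univ, .univ⟩, Set.subset_univ _⟩⟩
  obtain ⟨A, hA⟩ := exists_lt_of_ciInf_lt h
  exact ⟨A.1, A.2, hA⟩

theorem outer_nonneg (h0 : ∀ A, 0 ≤ μ A) (B : Set X) : 0 ≤ outer μ B :=
  Real.iInf_nonneg fun _ => h0 _

theorem outer_le_add (hμ : μ ∈ ba X) (h0 : ∀ A, 0 ≤ μ A) {B C D : Set X} (h : B ⊆ C ∪ D) :
    outer μ B ≤ outer μ C + outer μ D := by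
  refine le_of_forall_pos_le_add fun ε hε => ?_
  obtain ⟨A, hA, hA'⟩ := exists_of_outer_lt (lt_add_of_pos_right (outer μ C) (half_pos hε))
  obtain ⟨A2, hA2, hA2'⟩ := exists_of_outer_lt (lt_add_of_pos_right (outer μ D) (half_pos hε))
  have h1 := outer_le h0 (B := B) (A := ⟨A.1 ∪ A2.1, A.2.union A2.2⟩)
    (h.trans (Set.union_subset_union hA hA2))
  linarith [ba_union_le hμ h0 A A2]

open Classical in
/-- The set function as a family of operators, to use Mathlib's calculus of simple functions. -/
def opOf (μ : SetFun X) (A : Set X) : ℝ →L[ℝ] ℝ :=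
  (if h : MeasurableSet A then μ ⟨A, h⟩ else 0) • ContinuousLinearMap.id ℝ ℝ

theorem simpleIntegral_eq (μ : SetFun X) (s : SimpleFunc X ℝ) :
    simpleIntegral μ s = s.setToSimpleFunc (opOf μ) := by
  refine Finset.sum_congr rfl fun x _ => ?_
  simp [opOf, s.measurableSet_fiber x, mul_comm]

theorem opOf_add (hμ : μ ∈ ba X) : FinMeasAdditive (0 : Measure X) (opOf μ) := by
  intro A B hA hB _ _ hAB
  have := hμ.1 ⟨A, hA⟩ ⟨B, hB⟩ hAB
  simp only at this
  simp [opOf, hA, hB, hA.union hB, this, add_smul]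

theorem integrable_zero_meas (s : SimpleFunc X ℝ) : Integrable s (0 : Measure X) :=
  integrable_zero_measure

theorem simpleIntegral_add (hμ : μ ∈ ba X) (s t : SimpleFunc X ℝ) :
    simpleIntegral μ (s + t) = simpleIntegral μ s + simpleIntegral μ t := by
  simp only [simpleIntegral_eq]
  exact SimpleFunc.setToSimpleFunc_add _ (opOf_add hμ) (integrable_zero_meas s)
    (integrable_zero_meas t)

theorem simpleIntegral_smul (hμ : μ ∈ ba X) (c : ℝ) (s : SimpleFunc X ℝ) :
    simpleIntegral μ (c • s) = c * simpleIntegral μ s := by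
  simp only [simpleIntegral_eq]
  exact SimpleFunc.setToSimpleFunc_smul_real _ (opOf_add hμ) c (integrable_zero_meas s)

theorem simpleIntegral_sub (hμ : μ ∈ ba X) (s t : SimpleFunc X ℝ) :
    simpleIntegral μ (s - t) = simpleIntegral μ s - simpleIntegral μ t := by
  simp only [simpleIntegral_eq]
  exact SimpleFunc.setToSimpleFunc_sub _ (opOf_add hμ) (integrable_zero_meas s)
    (integrable_zero_meas t)

theorem simpleIntegral_nonneg (h0 : ∀ A, 0 ≤ μ A) {s : SimpleFunc X ℝ} (hs : ∀ x, 0 ≤ s x) :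
    0 ≤ simpleIntegral μ s := by
  refine Finset.sum_nonneg fun y hy => mul_nonneg ?_ (h0 _)
  obtain ⟨x, rfl⟩ := SimpleFunc.mem_range.1 hy
  exact hs x

theorem simpleIntegral_mono (hμ : μ ∈ ba X) (h0 : ∀ A, 0 ≤ μ A) {s t : SimpleFunc X ℝ}
    (h : ∀ x, s x ≤ t x) : simpleIntegral μ s ≤ simpleIntegral μ t := by
  have := simpleIntegral_nonneg h0 (s := t - s) (fun x => by simpa using h x)
  rw [simpleIntegral_sub hμ] at this
  linarith

theorem simpleIntegral_abs (hμ : μ ∈ ba X) (s : SimpleFunc X ℝ) :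
    |simpleIntegral μ s| ≤ simpleIntegral (totalVar μ) (s.map fun y => |y|) := by
  rw [simpleIntegral_eq (totalVar μ), SimpleFunc.map_setToSimpleFunc _
    (opOf_add (totalVar_mem hμ)) (integrable_zero_meas s) abs_zero]
  refine (Finset.abs_sum_le_sum_abs _ _).trans (Finset.sum_le_sum fun x _ => ?_)
  simp only [abs_mul, opOf, s.measurableSet_fiber x, dite_true, FunLike.coe_smul,
    ContinuousLinearMap.coe_id', Pi.smul_apply, id, smul_eq_mul]
  rw [mul_comm]
  exact mul_le_mul_of_nonneg_right (abs_le_totalVar hμ _) (abs_nonneg x)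

theorem simpleIntegral_indicator (hμ : μ ∈ ba X) (A : {A : Set X // MeasurableSet A}) (c : ℝ) :
    simpleIntegral μ (SimpleFunc.piecewise A.1 A.2 (SimpleFunc.const X c) (SimpleFunc.const X 0)) =
      c * μ A := by
  rw [simpleIntegral_eq, SimpleFunc.setToSimpleFunc_indicator _
    (opOf_add hμ).map_empty_eq_zero A.2]
  simp [opOf, A.2, mul_comm]

/-- `s` approximates `f` uniformly, up to null sets. -/
def UnifApprox (ν : Measure X) (s : ℕ → SimpleFunc X ℝ) (f : X → ℝ) : Prop :=
  ∀ k : ℕ, ∀ᵐ x ∂ν, |s k x - f x| ≤ 1 / ((k : ℝ) + 1)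

theorem exists_unifApprox {f : X → ℝ} (hf : Measurable f) {C : ℝ} (hC : ∀ᵐ x ∂ν, |f x| ≤ C) :
    ∃ s, UnifApprox ν s f := by
  have key : ∀ k : ℕ, ∃ s : SimpleFunc X ℝ, ∀ᵐ x ∂ν, |s x - f x| ≤ 1 / ((k : ℝ) + 1) := by
    intro k
    have hk : (0 : ℝ) < (k : ℝ) + 1 := by positivity
    let g : X → ℝ := fun x => max (-|C|) (min |C| (f x))
    have hg : Measurable g := measurable_const.max (measurable_const.min hf)
    have hgb : ∀ x, |g x| ≤ |C| := fun x => abs_le.2 ⟨le_max_left _ _,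
      max_le (by linarith [abs_nonneg C]) (min_le_left _ _)⟩
    let h : X → ℝ := fun x => (⌊g x * ((k : ℝ) + 1)⌋ : ℝ) / ((k : ℝ) + 1)
    have hh : Measurable h := by
      have h1 : Measurable fun x => ⌊g x * ((k : ℝ) + 1)⌋ := (hg.mul_const _).floor
      have h2 : Measurable fun z : ℤ => (z : ℝ) / ((k : ℝ) + 1) := measurable_from_top
      exact h2.comp h1
    have hfin : (Set.range h).Finite := by
      refine ((Set.finite_Icc ⌊-|C| * ((k : ℝ) + 1)⌋ ⌊|C| * ((k : ℝ) + 1)⌋).image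
        fun z : ℤ => (z : ℝ) / ((k : ℝ) + 1)).subset ?_
      rintro _ ⟨x, rfl⟩
      have := abs_le.1 (hgb x)
      exact ⟨_, ⟨Int.floor_le_floor (mul_le_mul_of_nonneg_right this.1 hk.le),
        Int.floor_le_floor (mul_le_mul_of_nonneg_right this.2 hk.le)⟩, rfl⟩
    refine ⟨⟨h, fun y => hh (measurableSet_singleton y), hfin⟩, ?_⟩
    filter_upwards [hC] with x hx
    have hxg : g x = f x := by
      have := abs_le.1 (hx.trans (le_abs_self C))
      simp only [g]
      rw [min_eq_right this.2, max_eq_right this.1]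
    change |h x - f x| ≤ _
    have h1 := Int.floor_le (g x * ((k : ℝ) + 1))
    have h2 := Int.lt_floor_add_one (g x * ((k : ℝ) + 1))
    rw [← hxg]
    simp only [h]
    have e : (⌊g x * ((k : ℝ) + 1)⌋ : ℝ) / ((k : ℝ) + 1) - g x =
        ((⌊g x * ((k : ℝ) + 1)⌋ : ℝ) - g x * ((k : ℝ) + 1)) / ((k : ℝ) + 1) := by
      field_simp
    rw [e, abs_div, abs_of_pos hk]
    gcongr
    exact abs_le.2 ⟨by linarith, by linarith⟩
  choose s hs using key
  exact ⟨s, hs⟩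

/-- An almost everywhere bound controls the integral of a simple function. -/
theorem simpleIntegral_ae_le (hμ : μ ∈ baW ν) {s : SimpleFunc X ℝ} {C : ℝ} (hC0 : 0 ≤ C)
    (hs : ∀ᵐ x ∂ν, |s x| ≤ C) :
    simpleIntegral (totalVar μ) (s.map fun y => |y|) ≤ C * totalVar μ ⟨Set.univ, .univ⟩ := by
  have hm := totalVar_mem hμ.1
  have h0 := totalVar_nonneg hμ.1
  obtain ⟨M, hM⟩ := s.exists_forall_norm_le
  have hN : MeasurableSet {x | C < |s x|} :=
    measurableSet_lt measurable_const (s.map fun y => |y|).measurable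
  have hN0 : totalVar μ ⟨_, hN⟩ = 0 := by
    refine totalVar_null hμ ?_
    simpa [ae_iff] using hs
  have h1 := simpleIntegral_mono hm h0 (s := s.map fun y => |y|)
    (t := SimpleFunc.piecewise _ hN (SimpleFunc.const X M) (SimpleFunc.const X 0) +
      SimpleFunc.piecewise Set.univ .univ (SimpleFunc.const X C) (SimpleFunc.const X 0)) (by
    intro x
    have hMx : |s x| ≤ M := hM x
    by_cases hx : C < |s x|
    · simp [hx]; linarith
    · simp [hx]; linarith)
  rw [simpleIntegral_add hm, simpleIntegral_indicator hm ⟨_, hN⟩,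
    simpleIntegral_indicator hm ⟨_, .univ⟩, hN0] at h1
  linarith

theorem UnifApprox.tendsto_sub (hμ : μ ∈ baW ν) {s : ℕ → SimpleFunc X ℝ} {f : X → ℝ}
    (h : UnifApprox ν s f) :
    Tendsto (fun p : ℕ × ℕ => simpleIntegral (totalVar μ) ((s p.1 - s p.2).map fun y => |y|))
      atTop (𝓝 0) := by
  have hb : ∀ p : ℕ × ℕ, simpleIntegral (totalVar μ) ((s p.1 - s p.2).map fun y => |y|) ≤
      (1 / ((p.1 : ℝ) + 1) + 1 / ((p.2 : ℝ) + 1)) * totalVar μ ⟨Set.univ, .univ⟩ := by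
    intro p
    refine simpleIntegral_ae_le hμ (by positivity) ?_
    filter_upwards [h p.1, h p.2] with x h1 h2
    have : (s p.1 - s p.2) x = (s p.1 x - f x) - (s p.2 x - f x) := by
      simp
    rw [this]
    exact (abs_sub _ _).trans (add_le_add h1 h2)
  refine squeeze_zero (fun p => simpleIntegral_nonneg (totalVar_nonneg hμ.1)
    (fun x => by simp)) hb ?_
  have t := tendsto_one_div_add_atTop_nhds_zero_nat (𝕜 := ℝ)
  have t1 : Tendsto (fun p : ℕ × ℕ => 1 / ((p.1 : ℝ) + 1) + 1 / ((p.2 : ℝ) + 1)) atTop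
      (𝓝 (0 + 0)) := by
    rw [← prod_atTop_atTop_eq]
    exact (t.comp tendsto_fst).add (t.comp tendsto_snd)
  simpa using t1.mul_const (totalVar μ ⟨Set.univ, .univ⟩)

theorem UnifApprox.convInMeasure (hμ : μ ∈ baW ν) {s : ℕ → SimpleFunc X ℝ} {f : X → ℝ}
    (h : UnifApprox ν s f) : ConvInMeasure μ (fun k => s k) f := by
  intro ε hε
  have t := tendsto_one_div_add_atTop_nhds_zero_nat (𝕜 := ℝ)
  refine tendsto_const_nhds.congr' ?_
  filter_upwards [t.eventually (gt_mem_nhds hε)] with k hk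
  have hnull : ν {x | ε < |s k x - f x|} = 0 := by
    refine measure_mono_null (fun x hx => ?_) (ae_iff.1 (h k))
    simp only [Set.mem_ofPred_eq, not_le] at hx ⊢
    exact hk.trans hx
  obtain ⟨N, hN, hNm, hN0⟩ := exists_measurable_superset_of_null hnull
  refine le_antisymm (outer_nonneg (totalVar_nonneg hμ.1) _) ?_
  refine (outer_le (totalVar_nonneg hμ.1) (A := ⟨N, hNm⟩) hN).trans ?_
  rw [totalVar_null hμ hN0]

theorem UnifApprox.cauchySeq (hμ : μ ∈ baW ν) {s : ℕ → SimpleFunc X ℝ} {f : X → ℝ}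
    (h : UnifApprox ν s f) : CauchySeq fun k => simpleIntegral μ (s k) := by
  rw [cauchySeq_iff_tendsto_dist_atTop_0]
  refine squeeze_zero (fun _ => dist_nonneg) (fun p => ?_) (h.tendsto_sub hμ)
  rw [Real.dist_eq, ← simpleIntegral_sub hμ.1]
  exact simpleIntegral_abs hμ.1 _

theorem UnifApprox.hasIntegral (hμ : μ ∈ baW ν) {s : ℕ → SimpleFunc X ℝ} {f : X → ℝ}
    (h : UnifApprox ν s f) {c : ℝ} (hc : Tendsto (fun k => simpleIntegral μ (s k)) atTop (𝓝 c)) :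
    HasIntegral μ f c :=
  ⟨s, h.convInMeasure hμ, h.tendsto_sub hμ, hc⟩

theorem HasIntegral.add_smul (hμ : μ ∈ ba X) {f g : X → ℝ} {c d : ℝ} (a : ℝ)
    (hf : HasIntegral μ f c) (hg : HasIntegral μ g d) :
    HasIntegral μ (fun x => f x + a * g x) (c + a * d) := by
  obtain ⟨s, s1, s2, s3⟩ := hf
  obtain ⟨t, t1, t2, t3⟩ := hg
  have hm := totalVar_mem hμ
  have h0 := totalVar_nonneg hμ
  refine ⟨fun k => s k + a • t k, fun ε hε => ?_, ?_, ?_⟩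
  · have ha : 0 < |a| + 1 := by positivity
    have e1 := s1 (ε / 2) (by positivity)
    have e2 := t1 (ε / 2 / (|a| + 1)) (by positivity)
    refine squeeze_zero (fun k => outer_nonneg h0 _) (fun k => outer_le_add hm h0 ?_)
      (by simpa using e1.add e2)
    intro x hx
    by_contra hcon
    simp only [Set.mem_union, Set.mem_ofPred_eq, not_or, not_lt] at hcon hx
    rw [le_div_iff₀ ha] at hcon
    have : (s k + a • t k) x - (f x + a * g x) = (s k x - f x) + a * (t k x - g x) := by
      simp; ring
    rw [this] at hx
    have h3 := abs_add_le (s k x - f x) (a * (t k x - g x))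
    rw [abs_mul] at h3
    nlinarith [abs_nonneg (t k x - g x), abs_nonneg a]
  · have hb : ∀ p : ℕ × ℕ, simpleIntegral (totalVar μ)
        (((s p.1 + a • t p.1) - (s p.2 + a • t p.2)).map fun y => |y|) ≤
        simpleIntegral (totalVar μ) ((s p.1 - s p.2).map fun y => |y|) +
        |a| * simpleIntegral (totalVar μ) ((t p.1 - t p.2).map fun y => |y|) := by
      intro p
      rw [← simpleIntegral_smul hm, ← simpleIntegral_add hm]
      refine simpleIntegral_mono hm h0 fun x => ?_
      have e : s p.1 x + a * t p.1 x - (s p.2 x + a * t p.2 x) =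
        (s p.1 x - s p.2 x) + a * (t p.1 x - t p.2 x) := by ring
      have := abs_add_le (s p.1 x - s p.2 x) (a * (t p.1 x - t p.2 x))
      simpa [e, abs_mul] using this
    refine squeeze_zero (fun p => simpleIntegral_nonneg h0 fun x => by simp) hb ?_
    simpa using s2.add (t2.const_mul |a|)
  · simp only [simpleIntegral_add hμ, simpleIntegral_smul hμ]
    exact s3.add (t3.const_mul a)

theorem HasIntegral.abs_le (hμ : μ ∈ baW ν) {f : X → ℝ} {c C : ℝ} (hC0 : 0 ≤ C)
    (hf : HasIntegral μ f c) (hC : ∀ᵐ x ∂ν, |f x| ≤ C) :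
    |c| ≤ C * totalVar μ ⟨Set.univ, .univ⟩ := by
  obtain ⟨s, s1, s2, s3⟩ := hf
  have hm := totalVar_mem hμ.1
  have h0 := totalVar_nonneg hμ.1
  set P := totalVar μ with hP
  obtain ⟨N, hN, hNm, hN0⟩ := exists_measurable_superset_of_null (ae_iff.1 hC)
  have hPN : P ⟨N, hNm⟩ = 0 := totalVar_null hμ hN0
  have key : ∀ ε : ℝ, 0 < ε → |c| ≤ ε + (C + ε) * P ⟨Set.univ, .univ⟩ := by
    intro ε hε
    have s2' := s2.eventually (gt_mem_nhds hε)
    rw [eventually_atTop_prod_self'] at s2'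
    obtain ⟨K, hK⟩ := s2'
    obtain ⟨M, hM⟩ := (s K).exists_forall_norm_le
    have hM0 : ∀ x, |s K x| ≤ |M| := fun x => (hM x).trans (le_abs_self M)
    have bound : ∀ k, K ≤ k → |simpleIntegral μ (s k)| ≤ ε +
        |M| * (outer P {x | ε < |s k x - f x|} + 1 / ((k : ℝ) + 1)) +
        (C + ε) * P ⟨Set.univ, .univ⟩ := by
      intro k hk
      have hkp : (0 : ℝ) < 1 / ((k : ℝ) + 1) := by positivity
      obtain ⟨B, hB, hB'⟩ := exists_of_outer_lt
        (lt_add_of_pos_right (outer P {x | ε < |s k x - f x|}) hkp)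
      have hBN : P ⟨B.1 ∪ N, B.2.union hNm⟩ ≤ outer P {x | ε < |s k x - f x|} +
          1 / ((k : ℝ) + 1) := by
        have := ba_union_le hm h0 B ⟨N, hNm⟩
        rw [hPN] at this
        linarith
      have h1 := simpleIntegral_mono hm h0 (s := (s k).map fun y => |y|)
        (t := (s k - s K).map (fun y => |y|) +
          SimpleFunc.piecewise (B.1 ∪ N) (B.2.union hNm) (SimpleFunc.const X |M|)
            (SimpleFunc.const X 0) +
          SimpleFunc.piecewise Set.univ .univ (SimpleFunc.const X (C + ε))
            (SimpleFunc.const X 0)) (by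
        intro x
        by_cases hx : x ∈ B.1 ∪ N
        · have e := abs_add_le (s k x - s K x) (s K x)
          rw [sub_add_cancel] at e
          simp only [SimpleFunc.coe_map, Function.comp_apply, SimpleFunc.coe_add, Pi.add_apply,
            SimpleFunc.coe_sub, Pi.sub_apply, SimpleFunc.piecewise_apply, hx, if_true,
            SimpleFunc.const_apply, Set.mem_univ]
          linarith [hM0 x]
        · simp only [SimpleFunc.coe_map, Function.comp_apply, SimpleFunc.coe_add, Pi.add_apply,
            SimpleFunc.coe_sub, Pi.sub_apply, SimpleFunc.piecewise_apply, hx, if_true, if_false,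
            SimpleFunc.const_apply, Set.mem_univ]
          have hx1 : |s k x - f x| ≤ ε := by
            by_contra hcon
            exact hx (Or.inl (hB (not_le.1 hcon)))
          have hx2 : |f x| ≤ C := by
            by_contra hcon
            exact hx (Or.inr (hN hcon))
          have e := abs_add_le (s k x - f x) (f x)
          rw [sub_add_cancel] at e
          linarith [abs_nonneg (s k x - s K x)])
      rw [simpleIntegral_add hm, simpleIntegral_add hm,
        simpleIntegral_indicator hm ⟨_, B.2.union hNm⟩,
        simpleIntegral_indicator hm ⟨_, .univ⟩] at h1
      have h2 := simpleIntegral_abs hμ.1 (s k)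
      have h3 := hK k hk K le_rfl
      have h4 := mul_le_mul_of_nonneg_left hBN (abs_nonneg M)
      simp only at h3
      linarith
    have lim : Tendsto (fun k : ℕ => ε +
        |M| * (outer P {x | ε < |s k x - f x|} + 1 / ((k : ℝ) + 1)) +
        (C + ε) * P ⟨Set.univ, .univ⟩) atTop
        (𝓝 (ε + |M| * (0 + 0) + (C + ε) * P ⟨Set.univ, .univ⟩)) :=
      ((((s1 ε hε).add tendsto_one_div_add_atTop_nhds_zero_nat).const_mul |M|).const_add
        ε).add_const _
    have := le_of_tendsto_of_tendsto s3.abs lim (eventually_atTop.2 ⟨K, bound⟩)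
    simpa using this
  have lim : Tendsto (fun ε : ℝ => ε + (C + ε) * P ⟨Set.univ, .univ⟩) (𝓝[>] 0)
      (𝓝 (0 + (C + 0) * P ⟨Set.univ, .univ⟩)) :=
    Tendsto.mono_left (Continuous.tendsto (by fun_prop) 0) nhdsWithin_le_nhds
  have := ge_of_tendsto lim (eventually_nhdsWithin_of_forall key)
  simpa using this

/-- The integral is well defined, also on classes modulo equality `ν`-almost everywhere. -/
theorem HasIntegral.unique (hμ : μ ∈ baW ν) {f g : X → ℝ} {c d : ℝ} (hf : HasIntegral μ f c)
    (hg : HasIntegral μ g d) (hfg : f =ᵐ[ν] g) : c = d := by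
  have h := (hf.add_smul hμ.1 (-1) hg).abs_le hμ le_rfl
    (by filter_upwards [hfg] with x hx; simp [hx])
  have h2 : c + -1 * d = 0 := abs_nonpos_iff.1 (by simpa using h)
  linarith

theorem ae_le_norm (f : Lp ℝ ∞ ν) : ∀ᵐ x ∂ν, |f x| ≤ ‖f‖ := by
  have h := ae_le_eLpNormEssSup (f := (f : X → ℝ)) (μ := ν)
  filter_upwards [h] with x hx
  have hfin : eLpNorm f ∞ ν ≠ ∞ := Lp.eLpNorm_ne_top f
  rw [Lp.norm_def, eLpNorm_exponent_top] at *
  rw [← eLpNorm_exponent_top, eLpNorm_exponent_top] at hx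
  have := ENNReal.toReal_mono hfin hx
  simpa using this

theorem exists_unifApprox_Lp (f : Lp ℝ ∞ ν) : ∃ s, UnifApprox ν s f :=
  exists_unifApprox (Lp.stronglyMeasurable f).measurable (ae_le_norm f)

/-- Essentially bounded functions are integrable with respect to every member of `ba_w`. -/
theorem hasIntegral_integral (hμ : μ ∈ baW ν) (f : Lp ℝ ∞ ν) :
    HasIntegral μ f (integral μ f) := by
  have h : ∃ c, HasIntegral μ f c := by
    obtain ⟨s, hs⟩ := exists_unifApprox_Lp f
    obtain ⟨c, hc⟩ := cauchySeq_tendsto_of_complete (hs.cauchySeq hμ)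
    exact ⟨c, hs.hasIntegral hμ hc⟩
  rw [integral, dif_pos h]
  exact h.choose_spec

theorem hasIntegral_simple (hμ : μ ∈ baW ν) (s : SimpleFunc X ℝ) :
    HasIntegral μ s (simpleIntegral μ s) := by
  have h : UnifApprox ν (fun _ => s) s := fun k => ae_of_all _ fun x => by
    simp only [sub_self, abs_zero]; positivity
  exact h.hasIntegral hμ tendsto_const_nhds

theorem integral_add (hμ : μ ∈ baW ν) (f g : Lp ℝ ∞ ν) :
    integral μ (f + g : Lp ℝ ∞ ν) = integral μ f + integral μ g := by
  have h := (hasIntegral_integral hμ f).add_smul hμ.1 (1 : ℝ) (hasIntegral_integral hμ g)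
  have e := (hasIntegral_integral hμ (f + g)).unique hμ h
    (by filter_upwards [Lp.coeFn_add f g] with x hx; rw [hx, Pi.add_apply, one_mul])
  linarith

theorem integral_smul (hμ : μ ∈ baW ν) (a : ℝ) (f : Lp ℝ ∞ ν) :
    integral μ (a • f : Lp ℝ ∞ ν) = a * integral μ f := by
  have h := (hasIntegral_simple hμ (0 : SimpleFunc X ℝ)).add_smul hμ.1 a (hasIntegral_integral hμ f)
  have e := (hasIntegral_integral hμ (a • f)).unique hμ h
    (by filter_upwards [Lp.coeFn_smul a f] with x hx; rw [hx]; simp)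
  have z : simpleIntegral μ (0 : SimpleFunc X ℝ) = 0 := by
    have := simpleIntegral_smul hμ.1 0 (0 : SimpleFunc X ℝ)
    simpa using this
  rw [e, z, zero_add]

theorem memLp_simple (ν : Measure X) (s : SimpleFunc X ℝ) : MemLp s ∞ ν := s.memLp_top ν

theorem integral_toLp_simple (hμ : μ ∈ baW ν) (s : SimpleFunc X ℝ) :
    integral μ ((memLp_simple ν s).toLp s) = simpleIntegral μ s :=
  (hasIntegral_integral hμ _).unique hμ (hasIntegral_simple hμ s) (MemLp.coeFn_toLp _)

theorem toLp_tendsto {f : Lp ℝ ∞ ν} {s : ℕ → SimpleFunc X ℝ} (hs : UnifApprox ν s f) :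
    Tendsto (fun k => (memLp_simple ν (s k)).toLp (s k)) atTop (𝓝 f) := by
  rw [tendsto_iff_norm_sub_tendsto_zero]
  refine squeeze_zero (fun _ => norm_nonneg _) (fun k => ?_)
    (tendsto_one_div_add_atTop_nhds_zero_nat (𝕜 := ℝ))
  have hk : (0 : ℝ) ≤ 1 / ((k : ℝ) + 1) := by positivity
  rw [Lp.norm_def, eLpNorm_exponent_top]
  refine ENNReal.toReal_le_of_le_ofReal hk (eLpNormEssSup_le_of_ae_bound ?_)
  filter_upwards [hs k, Lp.coeFn_sub ((memLp_simple ν (s k)).toLp (s k)) f,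
    (memLp_simple ν (s k)).coeFn_toLp] with x h1 h2 h3
  rw [h2, Pi.sub_apply, h3]
  exact h1

/-- The set function `A ↦ L(1_A)` of a functional `L` on `L^∞(ν)`. -/
def setFunOf (L : StrongDual ℝ (Lp ℝ ∞ ν)) : SetFun X := fun A =>
  L ((memLp_simple ν (SimpleFunc.piecewise A.1 A.2 (SimpleFunc.const X 1)
    (SimpleFunc.const X 0))).toLp _)

theorem setFunOf_add (L : StrongDual ℝ (Lp ℝ ∞ ν)) (s t : SimpleFunc X ℝ) :
    L ((memLp_simple ν (s + t)).toLp _) =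
      L ((memLp_simple ν s).toLp s) + L ((memLp_simple ν t).toLp t) := by
  rw [← map_add]
  rfl

theorem setFunOf_mem (L : StrongDual ℝ (Lp ℝ ∞ ν)) : setFunOf L ∈ baW ν := by
  refine ⟨⟨fun A B hAB => ?_, ‖L‖, fun A => ?_⟩, fun A hA => ?_⟩
  · rw [setFunOf, setFunOf, setFunOf, ← setFunOf_add]
    congr 2
    ext x
    have : x ∈ A.1 → x ∉ B.1 := fun h1 h2 => Set.disjoint_left.1 hAB h1 h2
    by_cases h1 : x ∈ A.1 <;> by_cases h2 : x ∈ B.1 <;> simp_all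
  · refine (L.le_opNorm _).trans (mul_le_of_le_one_right (norm_nonneg _) ?_)
    rw [Lp.norm_toLp, eLpNorm_exponent_top]
    refine ENNReal.toReal_le_of_le_ofReal zero_le_one (eLpNormEssSup_le_of_ae_bound ?_)
    refine ae_of_all _ fun x => ?_
    by_cases h1 : x ∈ A.1 <;> simp [h1]
  · have : ((memLp_simple ν (SimpleFunc.piecewise A.1 A.2 (SimpleFunc.const X 1)
        (SimpleFunc.const X 0))).toLp _ : Lp ℝ ∞ ν) = 0 := by
      rw [Lp.ext_iff]
      filter_upwards [MemLp.coeFn_toLp (memLp_simple ν (SimpleFunc.piecewise A.1 A.2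
        (SimpleFunc.const X 1) (SimpleFunc.const X 0))), Lp.coeFn_zero ℝ ∞ ν,
        measure_eq_zero_iff_ae_notMem.1 hA] with x h1 h2 h3
      rw [h1, h2]
      simp [h3]
    rw [setFunOf, this, map_zero]

theorem simpleIntegral_setFunOf (L : StrongDual ℝ (Lp ℝ ∞ ν)) (s : SimpleFunc X ℝ) :
    simpleIntegral (setFunOf L) s = L ((memLp_simple ν s).toLp s) := by
  induction s using SimpleFunc.induction with
  | const c hA =>
    rw [simpleIntegral_indicator (setFunOf_mem L).1 ⟨_, hA⟩, setFunOf, ← smul_eq_mul, ← map_smul,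
      ← MemLp.toLp_const_smul]
    congr 2
    ext x
    simp only [SimpleFunc.coe_piecewise, SimpleFunc.coe_const, Pi.smul_apply, Set.piecewise,
      Function.const_apply]
    split_ifs <;> simp
  | add _ hf hg =>
    rw [simpleIntegral_add (setFunOf_mem L).1, hf, hg, setFunOf_add]

theorem UnifApprox.tendsto_integral (hμ : μ ∈ baW ν) {s : ℕ → SimpleFunc X ℝ} {f : Lp ℝ ∞ ν}
    (h : UnifApprox ν s f) :
    Tendsto (fun k => simpleIntegral μ (s k)) atTop (𝓝 (integral μ f)) := by
  obtain ⟨c, hc⟩ := cauchySeq_tendsto_of_complete (h.cauchySeq hμ)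
  rwa [(hasIntegral_integral hμ f).unique hμ (h.hasIntegral hμ hc) (ae_eq_refl _)]

theorem integral_lin (a : ℝ) {η : SetFun X} (hμ : μ ∈ baW ν) (hη : η ∈ baW ν) (f : Lp ℝ ∞ ν) :
    integral (μ + a • η) f = integral μ f + a * integral η f := by
  obtain ⟨s, hs⟩ := exists_unifApprox_Lp f
  refine tendsto_nhds_unique
    (hs.tendsto_integral ((baW ν).add_mem hμ ((baW ν).smul_mem a hη))) ?_
  refine ((hs.tendsto_integral hμ).add ((hs.tendsto_integral hη).const_mul a)).congr fun k => ?_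
  simp only [simpleIntegral, Finset.mul_sum, ← Finset.sum_add_distrib, Pi.add_apply,
    Pi.smul_apply, smul_eq_mul]
  exact Finset.sum_congr rfl fun x _ => by ring

end Facts

/-- The functional `f ↦ ∫ f dμ` on `L^∞(ν)` that is given by `μ ∈ ba_w(ν)`. -/
def integralDual {ν : Measure X} (μ : baW ν) : StrongDual ℝ (Lp ℝ ∞ ν) :=
  LinearMap.mkContinuous
    { toFun := fun f : Lp ℝ ∞ ν => integral μ.1 f
      map_add' := integral_add μ.2
      map_smul' := integral_smul μ.2 }
    (totalVar μ.1 ⟨Set.univ, .univ⟩)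
    (fun f => by
      rw [mul_comm]
      exact (hasIntegral_integral μ.2 f).abs_le μ.2 (norm_nonneg f) (ae_le_norm f))

theorem integralDual_apply {ν : Measure X} (μ : baW ν) (f : Lp ℝ ∞ ν) :
    integralDual μ f = integral μ.1 f := rfl

theorem integralDual_injective (ν : Measure X) :
    Function.Injective (integralDual : baW ν → StrongDual ℝ (Lp ℝ ∞ ν)) := by
  intro μ η h
  ext A
  have h1 := DFunLike.congr_fun h ((memLp_simple ν (SimpleFunc.piecewise A.1 A.2
    (SimpleFunc.const X 1) (SimpleFunc.const X 0))).toLp _)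
  rw [integralDual_apply, integralDual_apply, integral_toLp_simple μ.2,
    integral_toLp_simple η.2, simpleIntegral_indicator μ.2.1, simpleIntegral_indicator η.2.1,
    one_mul, one_mul] at h1
  exact h1

theorem integralDual_surjective (ν : Measure X) :
    Function.Surjective (integralDual : baW ν → StrongDual ℝ (Lp ℝ ∞ ν)) := by
  intro L
  refine ⟨⟨setFunOf L, setFunOf_mem L⟩, ContinuousLinearMap.ext fun f => ?_⟩
  obtain ⟨s, hs⟩ := exists_unifApprox_Lp f
  refine tendsto_nhds_unique (hs.tendsto_integral (setFunOf_mem L)) ?_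
  refine ((L.continuous.tendsto f).comp (toLp_tendsto hs)).congr fun k => ?_
  exact (simpleIntegral_setFunOf L (s k)).symm

/-- The identification of `ba_w(ν)` with the dual of `L^∞(ν)`, by `μ ↦ (f ↦ ∫ f dμ)`. -/
def equivDual (ν : Measure X) : baW ν ≃ₗ[ℝ] StrongDual ℝ (Lp ℝ ∞ ν) :=
  LinearEquiv.ofBijective
    { toFun := integralDual
      map_add' := fun μ η => ContinuousLinearMap.ext fun f => by
        have h := integral_lin 1 μ.2 η.2 f
        rw [one_smul, one_mul] at h
        exact h
      map_smul' := fun a μ => ContinuousLinearMap.ext fun f => by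
        have h := integral_lin a (baW ν).zero_mem μ.2 f
        have h0 := integral_lin (-1) μ.2 μ.2 f
        rw [neg_one_smul, add_neg_cancel] at h0
        rw [zero_add, h0, neg_one_mul, add_neg_cancel, zero_add] at h
        exact h }
    ⟨integralDual_injective ν, integralDual_surjective ν⟩

/-- The same identification, with the dual carrying the weak* topology. -/
def toWeakDual (ν : Measure X) : baW ν ≃ₗ[ℝ] WeakDual ℝ (Lp ℝ ∞ ν) :=
  (equivDual ν).trans StrongDual.toWeakDual

theorem toWeakDual_apply {ν : Measure X} (μ : baW ν) (f : Lp ℝ ∞ ν) :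
    toWeakDual ν μ f = integral μ.1 f := rfl

/-- Lebesgue measure on (the Borel sets of) a Borel subset `Ω` of `ℝⁿ`. -/
def lebesgueOn {n : ℕ} (Ω : Set (EuclideanSpace ℝ (Fin n))) : Measure Ω :=
  Measure.comap Subtype.val volume

/-- The density measures for `F` on `Ω`: the `μ ≥ 0` in `ba_w(Ω, λ)`, with `λ` the Lebesgue measure
on `Ω`, such that `μ(F_δ ∩ Ω) = μ(Ω) = 1` for all `δ > 0`. Here `F_δ` is the open
`δ`-neighbourhood of `F`; subsets of `Ω` are written as sets of elements of the subtype. -/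
def densityMeasures {n : ℕ} (Ω F : Set (EuclideanSpace ℝ (Fin n))) : Set (baW (lebesgueOn Ω)) :=
  {μ | (∀ A, 0 ≤ μ.1 A) ∧ μ.1 ⟨Set.univ, .univ⟩ = 1 ∧ ∀ δ : ℝ, 0 < δ →
    μ.1 ⟨Subtype.val ⁻¹' Metric.thickening δ F,
      Metric.isOpen_thickening.measurableSet.preimage measurable_subtype_coe⟩ = 1}

end FinAdd

end

namespace FinAdd

variable {X : Type*} [MeasurableSpace X] {ν : Measure X}

/-! Under the identification with the dual of `L^∞`, the number `μ(A)` is the value of the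
functional at the class of `1_A` (`toWeakDual_indicatorLp`). Hence every condition that defines a
density measure is a linear inequality or a linear equation in evaluations at fixed elements of
`L^∞`: `φ(1_A) ≥ 0` for all `A`, `φ(1) = 1`, and `φ(1_{F_δ}) = 1` for all `δ > 0`.

Such conditions survive convex combinations, which gives convexity. Evaluations are weak*
continuous, so the functionals that meet the conditions form an intersection of weak* closed
half-spaces and hyperplanes (`isClosed_image_densityMeasures`).

For compactness it remains to bound the norm. The functional of `μ` has norm at most `|μ|(Ω)`, and
for `μ ≥ 0` this is at most `μ(Ω)` (`norm_integralDual_le_of_nonneg`), which equals `1` here. The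
set is thus a weak* closed subset of the dual unit ball, which is weak* compact by Banach–Alaoglu.
-/

/-! ### Indicators as test functions, and the norm of a nonnegative set function -/

/-- The class of the indicator function of `A` in `L^∞(ν)`. -/
noncomputable def indicatorLp (ν : Measure X) (A : {A : Set X // MeasurableSet A}) : Lp ℝ ∞ ν :=
  (memLp_simple ν (SimpleFunc.piecewise A.1 A.2 (SimpleFunc.const X 1)
    (SimpleFunc.const X 0))).toLp _

/-- An indicator is a simple function, so its integral is the finite sum `1 * μ(A) + 0 * μ(Aᶜ)`.
This turns conditions on set functions into conditions on functionals. -/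
theorem toWeakDual_indicatorLp (μ : baW ν) (A : {A : Set X // MeasurableSet A}) :
    toWeakDual ν μ (indicatorLp ν A) = μ.1 A := by
  rw [toWeakDual_apply, indicatorLp, integral_toLp_simple μ.2, simpleIntegral_indicator μ.2.1,
    one_mul]

/-- By monotonicity the supremum that defines `μ⁺(A)` is at most `μ(A)`, and `μ⁻(A)` is a supremum
of the numbers `-μ(B) ≤ 0`. -/
theorem totalVar_le_of_nonneg {μ : SetFun X} (hμ : μ ∈ ba X) (h0 : ∀ A, 0 ≤ μ A)
    (A : {A : Set X // MeasurableSet A}) : totalVar μ A ≤ μ A := by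
  have h1 : posVar μ A ≤ μ A := posVar_le fun B hB => ba_mono hμ h0 hB
  have h2 : posVar (-μ) A ≤ 0 := posVar_le fun B _ => neg_nonpos.2 (h0 B)
  simp only [totalVar, Pi.add_apply]
  linarith

theorem norm_integralDual_le_of_nonneg (μ : baW ν) (h0 : ∀ A, 0 ≤ μ.1 A) :
    ‖integralDual μ‖ ≤ μ.1 ⟨Set.univ, .univ⟩ :=
  -- The continuity constant built into `integralDual` is the total variation of the whole space.
  (LinearMap.mkContinuous_norm_le _ (totalVar_nonneg μ.2.1 _) _).trans
    (totalVar_le_of_nonneg μ.2.1 h0 _)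

/-! ### Convexity -/

theorem convex_densityMeasures {n : ℕ} (Ω F : Set (EuclideanSpace ℝ (Fin n))) :
    Convex ℝ (densityMeasures Ω F) := by
  rintro μ ⟨h1, h2, h3⟩ η ⟨k1, k2, k3⟩ a b ha hb hab
  have e : ∀ A, (a • μ + b • η).1 A = a * μ.1 A + b * η.1 A := fun _ => rfl
  refine ⟨fun A => ?_, ?_, fun δ hδ => ?_⟩
  · rw [e]
    exact add_nonneg (mul_nonneg ha (h1 A)) (mul_nonneg hb (k1 A))
  · rw [e, h2, k2, mul_one, mul_one, hab]
  · rw [e, h3 δ hδ, k3 δ hδ, mul_one, mul_one, hab]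

/-! ### Weak* closedness and compactness -/

/-- Each condition tests `φ` at one fixed element of `L^∞` and is therefore weak* closed. Arbitrary
intersections of closed sets are closed, so no countability in `A` or `δ` is needed. -/
theorem isClosed_image_densityMeasures {n : ℕ} (Ω F : Set (EuclideanSpace ℝ (Fin n))) :
    IsClosed (toWeakDual (lebesgueOn Ω) '' densityMeasures Ω F) := by
  have e : toWeakDual (lebesgueOn Ω) '' densityMeasures Ω F =
      {φ | (∀ A, 0 ≤ φ (indicatorLp (lebesgueOn Ω) A)) ∧
        φ (indicatorLp (lebesgueOn Ω) ⟨Set.univ, .univ⟩) = 1 ∧ ∀ δ : ℝ, 0 < δ →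
        φ (indicatorLp (lebesgueOn Ω) ⟨Subtype.val ⁻¹' Metric.thickening δ F,
          Metric.isOpen_thickening.measurableSet.preimage measurable_subtype_coe⟩) = 1} := by
    ext φ
    -- Surjectivity is essential: a functional that meets the conditions on indicators must come
    -- from some `μ` in `ba_w`, or the image could be smaller than the closed set on the right.
    obtain ⟨μ, rfl⟩ := (toWeakDual (lebesgueOn Ω)).surjective φ
    rw [(toWeakDual (lebesgueOn Ω)).injective.mem_set_image]
    simp only [Set.mem_ofPred_eq, toWeakDual_indicatorLp, densityMeasures]
  rw [e]
  simp only [Set.ofPred_and, Set.ofPred_forall]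
  refine (isClosed_iInter fun A => ?_).inter (IsClosed.inter ?_
    (isClosed_iInter fun δ => isClosed_iInter fun _ => ?_))
  · exact isClosed_le continuous_const (WeakDual.eval_continuous _)
  · exact isClosed_eq (WeakDual.eval_continuous _) continuous_const
  · exact isClosed_eq (WeakDual.eval_continuous _) continuous_const

theorem isCompact_image_densityMeasures {n : ℕ} (Ω F : Set (EuclideanSpace ℝ (Fin n))) :
    IsCompact (toWeakDual (lebesgueOn Ω) '' densityMeasures Ω F) := by
  refine (WeakDual.isCompact_closedBall (𝕜 := ℝ) (E := Lp ℝ ∞ (lebesgueOn Ω)) 0 1).of_isClosed_subset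
    (isClosed_image_densityMeasures Ω F) ?_
  -- Positivity and total mass `1` already place `μ` in the unit ball; the condition on the
  -- neighbourhoods of `F` matters only for closedness.
  rintro _ ⟨μ, ⟨h0, h1, -⟩, rfl⟩
  have h := norm_integralDual_le_of_nonneg μ h0
  rw [h1] at h
  -- The ball in Banach–Alaoglu is a preimage from the normed dual, where `toWeakDual` unfolds to
  -- `integralDual`, so the norm bound applies directly.
  exact mem_closedBall_zero_iff.2 h

end FinAdd

/-- Compactness is stated for the image because `WeakDual` carries the weak* topology; `toWeakDual`
is a linear bijection, so this is compactness of the set itself under the identification. -/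
theorem mainTheorem7 {n : ℕ} (Ω F : Set (EuclideanSpace ℝ (Fin n))) (hΩ : MeasurableSet Ω)
    (hF : IsClosed F) (hF_ne : F.Nonempty) (hF_sub : F ⊆ closure Ω)
    (hF_null : volume (F ∩ Ω) = 0) :
    Convex ℝ (FinAdd.densityMeasures Ω F) ∧
      IsCompact (FinAdd.toWeakDual (FinAdd.lebesgueOn Ω) '' FinAdd.densityMeasures Ω F) :=
  ⟨FinAdd.convex_densityMeasures Ω F, FinAdd.isCompact_image_densityMeasures Ω F⟩
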